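/- Let $n\ge 10$ be an integer and let $c\in(0,1/2)$ be a real number such that $cn$ is an integer. Let $\Delta_{3,n}=\{x\in\mathbb{R}^3: x_i\ge 0,\ x_1+x_2+x_3=1,\ nx_i\in\mathbb{Z}\}$, let $\mathrm{Support}(x)=\{i:x_i\ne 0\}$, and let $\mathcal{G}$ be the graph on $\Delta_{3,n}$ with edge set $E_{3,n}=\{xy:\|x-y\|_1=2/n\}$. Let $s_i=e^i$ $(i=1,2,3)$ be the unit vectors, and for $i\neq j$ let $V_{ij}=\{x\in\Delta_{3,n}:\mathrm{Support}(x)\subseteq\{i,j\}\}$. An edge is a boundary edge if both its end nodes lie in one common $V_{ij}$. The instance $J$ is the graph $\mathcal{G}$ with the following edge costs, where $\rho=3/(5n)$ and $T_i=\{x\in\Delta_{3,n}:x_i>2/3\}$. An edge with no end node in $T_1\cup T_2\cup T_3$ costs $\rho$. For an edge $xy$ with at least one end node in $T_i$: if it is a boundary edge, its cost is $\left(\frac n3-n(1-\max(x_i,y_i))\right)\rho$ (so on each side at $e^i$ the edge closest to $e^i$ costs $\frac n3\rho$, the second closest costs $(\frac n3-1)\rho$, and so on); if it is not a boundary edge,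 it costs $0$ when it is parallel to the side opposite to $e^i$ (that is, $x_i=y_i$) and $\rho$ otherwise. A cut is a map $Q:\Delta_{3,n}\to\{1,2,3,4\}$ with $Q(s_i)=i$ for $i=1,2,3$. It is non-opposite if $Q(x)\in\mathrm{Support}(x)\cup\{4\}$ for every $x\in\Delta_{3,n}$. Let $\delta(Q)=\{xy\in E_{3,n}:Q(x)\ne Q(y)\}$; the cost of $Q$ on $J$ is the total cost of the edges in $\delta(Q)$. For $k\in\{1,2,3\}$ with $\{i,j,k\}=\{1,2,3\}$, let $\mathrm{Closure}(R_k)=\{x\in\Delta_{3,n}:x_k\ge 1-c\}$, let $R_k=\{x\in\Delta_{3,n}:x_k=1-c\}\cup\{x\in V_{ik}\cup V_{jk}:x_k\ge 1-c\}$, and let $\Gamma_k=\{xy\in E_{3,n}:x,y\in R_k\}$ be the set of red edges near $s_k$. Let $Q:\Delta_{3,n}\to\{1,2,3,4\}$ be a non-opposite cut. For each $i\in\{1,2,3\}$ let $A_i=\{v\in\mathrm{Closure}(R_i):Q(v)=4\}$ if $\delta(Q)\cap\Gamma_i=\emptyset$, and $A_i=\emptyset$ otherwise. Then the cost of $Q$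 on $J$ is at least $$1.2+0.4\sum_{i=1}^3\frac{|A_i|}{n^2}-\frac{5}{2n}.$$ -/

import Mathlib

namespace MultiwayCut

/-- Nodes of the discretized simplex `Δ_{3,n}`, represented by the integer vector `n • x`:
three natural numbers with sum `n`. -/
abbrev Node (n : ℕ) : Type := {a : Fin 3 → ℕ // ∑ i, a i = n}

instance (n : ℕ) : Fintype (Node n) :=
  Fintype.subtype (Finset.piAntidiag Finset.univ n) (by intro a; simp)

/-- The point of `ℝ³` with barycentric coordinates `x i = a i / n` that a node stands for. -/
noncomputable def Node.pt {n : ℕ} (x : Node n) : Fin 3 → ℝ := fun i => (x.1 i : ℝ) / n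

/-- The points of nodes are exactly `Δ_3 ∩ ((1/n) ℤ)^3`. -/
theorem range_pt {n : ℕ} (hn : 0 < n) :
    Set.range (Node.pt (n := n)) =
      stdSimplex ℝ (Fin 3) ∩ {x | ∀ i, ∃ z : ℤ, x i = (z : ℝ) / n} := by
  have hn' : (0 : ℝ) < n := by exact_mod_cast hn
  ext x
  constructor
  · rintro ⟨a, rfl⟩
    refine ⟨⟨fun i => by unfold Node.pt; positivity, ?_⟩, fun i => ⟨a.1 i, by simp [Node.pt]⟩⟩
    have h : ((∑ i, a.1 i : ℕ) : ℝ) = n := by exact_mod_cast congrArg (Nat.cast (R := ℝ)) a.2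
    simp only [Node.pt]
    rw [← Finset.sum_div, ← Nat.cast_sum, h]
    field_simp
  · rintro ⟨⟨h0, h1⟩, h2⟩
    choose z hz using h2
    have hz0 : ∀ i, 0 ≤ z i := by
      intro i
      have h := h0 i
      rw [hz i] at h
      by_contra hneg
      push Not at hneg
      have : (z i : ℝ) < 0 := by exact_mod_cast hneg
      exact absurd h (not_le.mpr (div_neg_of_neg_of_pos this hn'))
    have hcast : ∀ i, (((z i).toNat : ℕ) : ℝ) = z i := by
      intro i
      exact_mod_cast congrArg (Int.cast (R := ℝ)) (Int.toNat_of_nonneg (hz0 i))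
    refine ⟨⟨fun i => (z i).toNat, ?_⟩, ?_⟩
    · have h : ((∑ i, (z i).toNat : ℕ) : ℝ) = n := by
        rw [Nat.cast_sum]
        simp only [hcast]
        simp only [hz, ← Finset.sum_div] at h1
        field_simp at h1
        exact h1
      exact_mod_cast h
    · funext i
      simp only [Node.pt, hcast, hz]

theorem pt_injective {n : ℕ} (hn : 0 < n) : Function.Injective (Node.pt (n := n)) := by
  intro x y h
  have hn' : (n : ℝ) ≠ 0 := by positivity
  apply Subtype.ext
  funext i
  have := congrFun h i
  simp only [Node.pt] at this
  field_simp at this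
  exact_mod_cast this

/-- The terminal `s_i = e^i`. -/
def terminal (n : ℕ) (i : Fin 3) : Node n := ⟨Pi.single i n, by simp⟩

/-- The graph `𝒢 = (Δ_{3,n}, E_{3,n})`: distinct nodes at `ℓ¹`-distance `2 / n` are adjacent. -/
def graph (n : ℕ) : SimpleGraph (Node n) where
  Adj x y := x ≠ y ∧ ∑ i, |x.pt i - y.pt i| = 2 / n
  symm := ⟨fun x y h => ⟨h.1.symm, by simpa only [abs_sub_comm] using h.2⟩⟩
  loopless := ⟨fun _ h => h.1 rfl⟩

/-- The boundary nodes `V_{ij}` between `s_i` and `s_j`: support contained in `{i, j}`. -/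
def side (n : ℕ) (i j : Fin 3) : Set (Node n) := {x | Function.support x.pt ⊆ {i, j}}

/-- `Q : Δ_{3,n} → [4]` is a cut if `Q(s_i) = i`. The labels `1, 2, 3` are
`Fin.castSucc i` for `i : Fin 3`, and the label `4` is `Fin.last 3`. -/
def IsCut {n : ℕ} (Q : Node n → Fin 4) : Prop := ∀ i : Fin 3, Q (terminal n i) = i.castSucc

/-- A cut is non-opposite if `Q(x) ∈ Support(x) ∪ {4}` for every node `x`. -/
def IsNonOppositeCut {n : ℕ} (Q : Node n → Fin 4) : Prop :=
  IsCut Q ∧ ∀ x : Node n, Q x ∈ Fin.castSucc '' Function.support x.pt ∪ {Fin.last 3}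

/-- The cut-set `δ(Q)`: the edges whose two end nodes have different labels. -/
def cutSet {n : ℕ} (Q : Node n → Fin 4) : Set (Sym2 (Node n)) :=
  {e | ∃ x y, (graph n).Adj x y ∧ Q x ≠ Q y ∧ e = s(x, y)}

/-! ### The instance `J` -/

/-- The unit of cost `ρ = 3 / (5 n)`. -/
noncomputable def rho (n : ℕ) : ℝ := 3 / (5 * n)

/-- The corner triangle `T_i`; the middle hexagon is the set of nodes in no `T_i`. -/
def corner (n : ℕ) (i : Fin 3) : Set (Node n) := {x | 2 / 3 < x.pt i}

/-- The edge `xy` lies on the boundary of the triangle, that is, on some `L_{ij}`. -/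
def OnBoundary {n : ℕ} (x y : Node n) : Prop :=
  ∃ i j : Fin 3, i ≠ j ∧ x ∈ side n i j ∧ y ∈ side n i j

open Classical in
/-- Cost of an edge `xy` of the corner at `e^i` (at least one end node in `T_i`).
The boundary edges of the corner have costs `(n/3) ρ, (n/3 - 1) ρ, …` in the order of their
distance from `e^i`; the number of edges on the same side that are closer to `e^i` is
`n (1 - max (x_i, y_i))`. The other edges cost `0` if they are parallel to the side
opposite to `e^i`, and `ρ` if not. -/
noncomputable def cornerCost (n : ℕ) (i : Fin 3) (x y : Node n) : ℝ :=
  if OnBoundary x y then (n / 3 - n * (1 - max (x.pt i) (y.pt i))) * rho n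
  else if x.pt i = y.pt i then 0
  else rho n

open Classical in
/-- Cost of the edge `xy` in `J`; an edge with both end nodes in the hexagon costs `ρ`. -/
noncomputable def pairCost (n : ℕ) (x y : Node n) : ℝ :=
  if x ∈ corner n 0 ∨ y ∈ corner n 0 then cornerCost n 0 x y
  else if x ∈ corner n 1 ∨ y ∈ corner n 1 then cornerCost n 1 x y
  else if x ∈ corner n 2 ∨ y ∈ corner n 2 then cornerCost n 2 x y
  else rho n

open Classical in
theorem cornerCost_comm (n : ℕ) (i : Fin 3) (x y : Node n) :
    cornerCost n i x y = cornerCost n i y x := by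
  have h : OnBoundary x y ↔ OnBoundary y x := by
    constructor <;> rintro ⟨i, j, hij, h1, h2⟩ <;> exact ⟨i, j, hij, h2, h1⟩
  exact if_congr h (by rw [max_comm]) (if_congr eq_comm rfl rfl)

open Classical in
theorem pairCost_comm (n : ℕ) (x y : Node n) : pairCost n x y = pairCost n y x := by
  exact if_congr or_comm (cornerCost_comm n 0 x y)
    (if_congr or_comm (cornerCost_comm n 1 x y)
      (if_congr or_comm (cornerCost_comm n 2 x y) rfl))

/-- Edge costs `w` of the instance `J`. -/
noncomputable def edgeCost (n : ℕ) : Sym2 (Node n) → ℝ :=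
  Sym2.lift ⟨pairCost n, pairCost_comm n⟩

open Classical in
/-- `Cost_J(F) = ∑_{e ∈ F} w(e)`. -/
noncomputable def costJ (n : ℕ) (F : Set (Sym2 (Node n))) : ℝ :=
  ∑ e : Sym2 (Node n) with e ∈ F, edgeCost n e

/-! ### Red triangles -/

/-- The nodes `U_k` with `x_k = 1 - c`. -/
def levelNodes (n : ℕ) (c : ℝ) (k : Fin 3) : Set (Node n) := {x | x.pt k = 1 - c}

/-- The red nodes `R_k` near `s_k`. -/
def redNodes (n : ℕ) (c : ℝ) (k : Fin 3) : Set (Node n) :=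
  levelNodes n c k ∪ {x | (∃ i, i ≠ k ∧ x ∈ side n i k) ∧ 1 - c ≤ x.pt k}

/-- `Closure(R_k)`. -/
def redClosure (n : ℕ) (c : ℝ) (k : Fin 3) : Set (Node n) := {x | 1 - c ≤ x.pt k}

/-- The red edges `Γ_k` near `s_k`. -/
def redEdges (n : ℕ) (c : ℝ) (k : Fin 3) : Set (Sym2 (Node n)) :=
  {e | ∃ x y, (graph n).Adj x y ∧ x ∈ redNodes n c k ∧ y ∈ redNodes n c k ∧ e = s(x, y)}

open Classical in
/-- `A_i`: the nodes of `Closure(R_i)` labeled `4` if `Q` cuts no red edge near `s_i`,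
and the empty set otherwise. -/
noncomputable def redIsland {n : ℕ} (c : ℝ) (Q : Node n → Fin 4) (i : Fin 3) : Set (Node n) :=
  if cutSet Q ∩ redEdges n c i = ∅ then {v ∈ redClosure n c i | Q v = Fin.last 3} else ∅

end MultiwayCut

namespace MultiwayCut

/-! ### Cells of the triangulation -/

/-! Write `n = m + 1`. Every edge of the triangular grid lies in exactly one upward triangle (cell),
indexed by a `Node m`, so costs can be bounded cell by cell through `totalCost`. The bound comes
from relabelling the cut until its cut edges can be counted.

Islands. If no red edge near `s_i` is cut, all of `R_i` has label `i`, since the red nodes are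
connected to `s_i`. Giving label `i` to the whole closure cuts no new edge, and every line parallel
to a side at `s_i` that meets the island loses a cut edge of cost `ρ`. A line holds at most `n`
nodes, so the saving is at least `ρ|A_i|/n = 0.6|A_i|/n²` (`totalCost_fillCorner_add_le`). As `c <
1/2`, the three closures are disjoint and the savings add up.

Corners. Giving label `i` to all of `T_i`, one node at a time from `e^i` outwards, never raises the
cost (`exists_filled_corner`): the free parallel edges and the boundary costs decreasing by `ρ` are
tailored to this.

Counting. A non-opposite cut with filled corners cuts at least `2n` edges (`le_cuts`). If a
monochromatic component meets all three sides, it has label 4 and crosses every line at height below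
`n/3` over each side; such a line ends in two differently labelled corners, hence has two cut edges.
Otherwise each component misses a side. Send a monochromatic cell to the downward triangle across
its edge facing a side missed by its component. This is injective, and there are `n` fewer downward
triangles than cells, so at least `n` cells are not monochromatic, each with two cut edges.

Costs. After filling, a cut edge costs at least `ρ`, apart from at most six boundary edges that
enter a corner and cost at least `ρ/3`. The total is at least `2nρ - 4ρ = 1.2 - 2.4/n`. -/

/-- The vertex in direction `j` of the upward triangle with index `x`. -/
def up {m : ℕ} (x : Node m) (j : Fin 3) : Node (m + 1) :=
  ⟨x.1 + Pi.single j 1, by simp [Finset.sum_add_distrib, x.2]⟩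

theorem up_apply {m : ℕ} (x : Node m) (j i : Fin 3) :
    (up x j).1 i = x.1 i + if i = j then 1 else 0 := by
  simp [up, Pi.single_apply]

theorem up_self {m : ℕ} (x : Node m) (j : Fin 3) : (up x j).1 j = x.1 j + 1 := by
  simp [up_apply]

theorem up_of_ne {m : ℕ} (x : Node m) {i j : Fin 3} (h : i ≠ j) : (up x j).1 i = x.1 i := by
  simp [up_apply, h]

theorem up_injective {m : ℕ} (j : Fin 3) : Function.Injective (fun x : Node m => up x j) := by
  intro x y h
  apply Subtype.ext
  exact add_right_cancel (congrArg Subtype.val h)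

theorem up_ne_up {m : ℕ} (x : Node m) {i j : Fin 3} (h : i ≠ j) : up x i ≠ up x j := by
  intro e
  have := congrArg (fun v : Node (m + 1) => v.1 i) e
  simp only [up_self, up_of_ne x h] at this
  omega

theorem exists_up {m : ℕ} (v : Node (m + 1)) (j : Fin 3) (h : 0 < v.1 j) :
    ∃ x : Node m, up x j = v := by
  have hle : Pi.single j 1 ≤ v.1 := by
    intro i
    by_cases hij : i = j
    · subst hij
      simpa using Nat.succ_le_of_lt h
    · simp [hij]
  refine ⟨⟨v.1 - Pi.single j 1, ?_⟩, ?_⟩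
  · have h1 : ∑ i, (v.1 - Pi.single j 1 : Fin 3 → ℕ) i + ∑ i, (Pi.single j 1 : Fin 3 → ℕ) i
        = m + 1 := by
      rw [← Finset.sum_add_distrib]
      refine Eq.trans ?_ v.2
      exact Finset.sum_congr rfl fun i _ => Nat.sub_add_cancel (hle i)
    simp at h1
    simpa using h1
  · apply Subtype.ext
    exact tsub_add_cancel_of_le hle

theorem sum_fin_three {M : Type*} [AddCommMonoid M] (f : Fin 3 → M) (a : Fin 3) :
    ∑ k, f k = f a + f (a + 1) + f (a + 2) := by
  rw [Fin.sum_univ_three]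
  fin_cases a
  · rfl
  · change _ = f 1 + f 2 + f 0
    abel
  · change _ = f 2 + f 0 + f 1
    abel

theorem Node.sum_eq {n : ℕ} (v : Node n) (a : Fin 3) :
    v.1 a + v.1 (a + 1) + v.1 (a + 2) = n := by
  rw [← sum_fin_three, v.2]

theorem Node.sum_eq_of_ne {n : ℕ} (v : Node n) {p q r : Fin 3} (hpq : p ≠ q) (hpr : p ≠ r)
    (hqr : q ≠ r) : v.1 p + v.1 q + v.1 r = n := by
  have h := v.2
  rw [Fin.sum_univ_three] at h
  fin_cases p <;> fin_cases q <;> fin_cases r <;> simp at * <;> omega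

theorem Node.ext_of_two {n : ℕ} {u v : Node n} {p q : Fin 3} (hpq : p ≠ q)
    (hp : u.1 p = v.1 p) (hq : u.1 q = v.1 q) : u = v := by
  apply Subtype.ext
  funext r
  by_cases h1 : r = p
  · rw [h1, hp]
  by_cases h2 : r = q
  · rw [h2, hq]
  have := u.sum_eq_of_ne hpq (Ne.symm h1) (Ne.symm h2)
  have := v.sum_eq_of_ne hpq (Ne.symm h1) (Ne.symm h2)
  omega

theorem add_one_add_one (a : Fin 3) : a + 1 + 1 = a + 2 := by fin_cases a <;> rfl
theorem add_one_add_two (a : Fin 3) : a + 1 + 2 = a := by fin_cases a <;> rfl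
theorem add_two_add_one (a : Fin 3) : a + 2 + 1 = a := by fin_cases a <;> rfl
theorem add_two_add_two (a : Fin 3) : a + 2 + 2 = a + 1 := by fin_cases a <;> rfl
theorem ne_add_one (a : Fin 3) : a ≠ a + 1 := by fin_cases a <;> decide
theorem ne_add_two (a : Fin 3) : a ≠ a + 2 := by fin_cases a <;> decide
theorem add_one_ne_add_two (a : Fin 3) : a + 1 ≠ a + 2 := by fin_cases a <;> decide

theorem eq_or_eq_of_ne {a b : Fin 3} (h : b ≠ a) : b = a + 1 ∨ b = a + 2 := by
  fin_cases a <;> fin_cases b <;> first | exact absurd rfl h | decide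

/-! ### Edge costs in integer coordinates -/

theorem pt_div {n : ℕ} (v : Node n) (i : Fin 3) : v.pt i = (v.1 i : ℝ) / n := rfl

theorem mem_corner_iff {n : ℕ} (hn : 0 < n) (v : Node n) (i : Fin 3) :
    v ∈ corner n i ↔ 2 * n < 3 * v.1 i := by
  have hn' : (0 : ℝ) < n := by exact_mod_cast hn
  rw [corner, Set.mem_ofPred_eq, pt_div, div_lt_div_iff₀ (by norm_num) hn', mul_comm (v.1 i : ℝ)]
  exact_mod_cast Iff.rfl

theorem mem_side_iff {n : ℕ} (hn : 0 < n) (v : Node n) {i j k : Fin 3} (hij : i ≠ j)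
    (hik : i ≠ k) (hjk : j ≠ k) : v ∈ side n i j ↔ v.1 k = 0 := by
  have hn' : (n : ℝ) ≠ 0 := by positivity
  have hs : ∀ l, l ∈ Function.support v.pt ↔ v.1 l ≠ 0 := by
    intro l
    simp [pt_div, hn.ne']
  constructor
  · intro h
    by_contra hk
    have := h ((hs k).2 hk)
    simp only [Set.mem_insert_iff, Set.mem_singleton_iff] at this
    rcases this with h | h
    · exact hik h.symm
    · exact hjk h.symm
  · intro h l hl
    have := (hs l).1 hl
    by_contra hne
    simp only [Set.mem_insert_iff, Set.mem_singleton_iff, not_or] at hne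
    have : l = k := by
      clear hl this hs h
      revert i j k l
      decide
    subst this
    contradiction

theorem onBoundary_up_iff {m : ℕ} (x : Node m) (k : Fin 3) :
    OnBoundary (up x (k + 1)) (up x (k + 2)) ↔ x.1 k = 0 := by
  constructor
  · rintro ⟨i, j, hij, h1, h2⟩
    obtain ⟨l, hil, hjl⟩ : ∃ l, i ≠ l ∧ j ≠ l := by
      clear h1 h2
      revert i j
      decide
    rw [mem_side_iff (Nat.succ_pos m) _ hij hil hjl] at h1 h2
    have hl1 : l ≠ k + 1 := by
      rintro rfl
      rw [up_self] at h1
      omega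
    have hl2 : l ≠ k + 2 := by
      rintro rfl
      rw [up_self] at h2
      omega
    have hlk : l = k := by
      by_contra h
      rcases eq_or_eq_of_ne h with h | h
      · exact hl1 h
      · exact hl2 h
    subst hlk
    rwa [up_of_ne x hl1] at h1
  · intro h
    refine ⟨k + 1, k + 2, add_one_ne_add_two k, ?_, ?_⟩
    · rw [mem_side_iff (Nat.succ_pos m) _ (add_one_ne_add_two k) (ne_add_one k).symm
        (ne_add_two k).symm, up_of_ne x (ne_add_one k), h]
    · rw [mem_side_iff (Nat.succ_pos m) _ (add_one_ne_add_two k) (ne_add_one k).symm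
        (ne_add_two k).symm, up_of_ne x (ne_add_two k), h]

theorem rho_pos {n : ℕ} (hn : 0 < n) : 0 < rho n := by
  unfold rho
  positivity

theorem cornerCost_nonneg {n : ℕ} (i : Fin 3) (u v : Node n)
    (h : u ∈ corner n i ∨ v ∈ corner n i) : 0 ≤ cornerCost n i u v := by
  have hr : 0 ≤ rho n := by unfold rho; positivity
  unfold cornerCost
  split_ifs
  · apply mul_nonneg _ hr
    have hm : 2 / 3 < max (u.pt i) (v.pt i) := by
      rcases h with h | h
      · exact lt_max_of_lt_left h
      · exact lt_max_of_lt_right h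
    have hn : (0 : ℝ) ≤ n := Nat.cast_nonneg n
    nlinarith
  · exact le_rfl
  · exact hr

theorem pairCost_nonneg (n : ℕ) (u v : Node n) : 0 ≤ pairCost n u v := by
  unfold pairCost
  split_ifs with h0 h1 h2
  · exact cornerCost_nonneg 0 u v h0
  · exact cornerCost_nonneg 1 u v h1
  · exact cornerCost_nonneg 2 u v h2
  · unfold rho; positivity

theorem pairCost_of_corner {n : ℕ} (u v : Node n) (a : Fin 3)
    (ha : u ∈ corner n a ∨ v ∈ corner n a)
    (h1 : ∀ b, b ≠ a → ¬ (u ∈ corner n b ∨ v ∈ corner n b)) :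
    pairCost n u v = cornerCost n a u v := by
  unfold pairCost
  fin_cases a
  · exact if_pos ha
  · rw [if_neg (h1 0 (by decide))]
    exact if_pos ha
  · rw [if_neg (h1 0 (by decide)), if_neg (h1 1 (by decide))]
    exact if_pos ha

/-- The cost of the edge opposite to the vertex `up x k` in the cell `x`. -/
noncomputable def weight {m : ℕ} (x : Node m) (k : Fin 3) : ℝ :=
  pairCost (m + 1) (up x (k + 1)) (up x (k + 2))

theorem weight_nonneg {m : ℕ} (x : Node m) (k : Fin 3) : 0 ≤ weight x k :=
  pairCost_nonneg _ _ _

theorem up_le {m : ℕ} (x : Node m) (j i : Fin 3) : (up x j).1 i ≤ x.1 i + 1 := by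
  rw [up_apply]
  split_ifs <;> omega

theorem le_up {m : ℕ} (x : Node m) (j i : Fin 3) : x.1 i ≤ (up x j).1 i := by
  rw [up_apply]
  omega

theorem Node.add_le {n : ℕ} (v : Node n) {p q : Fin 3} (h : p ≠ q) : v.1 p + v.1 q ≤ n := by
  obtain ⟨r, h1, h2⟩ : ∃ r, p ≠ r ∧ q ≠ r := by
    revert p q
    decide
  have := v.sum_eq_of_ne h h1 h2
  omega

/-- No edge meets two corners, so the order of the cases in `pairCost` is immaterial. -/
theorem weight_eq_cornerCost {m : ℕ} (hm : 9 ≤ m) (x : Node m) (k a : Fin 3)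
    (h : 2 * (m + 1) < 3 * (up x (k + 1)).1 a ∨ 2 * (m + 1) < 3 * (up x (k + 2)).1 a) :
    weight x k = cornerCost (m + 1) a (up x (k + 1)) (up x (k + 2)) := by
  apply pairCost_of_corner
  · simpa only [mem_corner_iff (Nat.succ_pos m)] using h
  · intro b hb
    simp only [mem_corner_iff (Nat.succ_pos m)]
    have h1 := up_le x (k + 1) a
    have h2 := up_le x (k + 2) a
    have h3 := up_le x (k + 1) b
    have h4 := up_le x (k + 2) b
    have h5 := x.add_le hb
    omega

theorem weight_of_corner_parallel {m : ℕ} (hm : 9 ≤ m) (x : Node m) (k : Fin 3)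
    (h : 2 * (m + 1) < 3 * x.1 k) : weight x k = 0 := by
  rw [weight_eq_cornerCost hm x k k (by rw [up_of_ne x (ne_add_one k)]; exact Or.inl h),
    cornerCost, if_neg, if_pos]
  · simp only [pt_div, up_of_ne x (ne_add_one k), up_of_ne x (ne_add_two k)]
  · rw [onBoundary_up_iff]
    omega

theorem weight_of_corner {m : ℕ} (hm : 9 ≤ m) (x : Node m) {k b : Fin 3} (hb : b ≠ k)
    (h : 2 * (m + 1) < 3 * (x.1 b + 1)) :
    weight x k = if x.1 k = 0 then ((x.1 b : ℝ) + 1 - 2 * ((m : ℝ) + 1) / 3) * rho (m + 1)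
      else rho (m + 1) := by
  have hm0 : (m : ℝ) + 1 ≠ 0 := by positivity
  have hmp : (0 : ℝ) < (m : ℝ) + 1 := by positivity
  have hmax : max ((up x (k + 1)).pt b) ((up x (k + 2)).pt b) = ((x.1 b : ℝ) + 1) / (m + 1)
      ∧ (up x (k + 1)).pt b ≠ (up x (k + 2)).pt b
      ∧ (2 * (m + 1) < 3 * (up x (k + 1)).1 b ∨ 2 * (m + 1) < 3 * (up x (k + 2)).1 b) := by
    simp only [pt_div]
    push_cast
    rcases eq_or_eq_of_ne hb with rfl | rfl
    · rw [up_self, up_of_ne x (add_one_ne_add_two k)]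
      refine ⟨?_, ?_, Or.inl h⟩
      · push_cast
        apply max_eq_left
        gcongr
        linarith
      · push_cast
        rw [Ne, div_left_inj' hm0]
        linarith
    · rw [up_self, up_of_ne x (add_one_ne_add_two k).symm]
      refine ⟨?_, ?_, Or.inr h⟩
      · push_cast
        apply max_eq_right
        gcongr
        linarith
      · push_cast
        rw [Ne, div_left_inj' hm0]
        linarith
  rw [weight_eq_cornerCost hm x k b hmax.2.2, cornerCost, hmax.1]
  simp only [onBoundary_up_iff, if_neg hmax.2.1]
  congr 2
  push_cast
  field_simp
  ring

theorem weight_of_center {m : ℕ} (x : Node m) {k : Fin 3} (hk : 3 * x.1 k ≤ 2 * (m + 1))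
    (h1 : 3 * (x.1 (k + 1) + 1) ≤ 2 * (m + 1)) (h2 : 3 * (x.1 (k + 2) + 1) ≤ 2 * (m + 1)) :
    weight x k = rho (m + 1) := by
  have h : ∀ a, ¬ (up x (k + 1) ∈ corner (m + 1) a ∨ up x (k + 2) ∈ corner (m + 1) a) := by
    intro a
    simp only [mem_corner_iff (Nat.succ_pos m)]
    by_cases ha : a = k
    · subst ha
      rw [up_of_ne x (ne_add_one a), up_of_ne x (ne_add_two a)]
      omega
    · have h3 := up_le x (k + 1) a
      have h4 := up_le x (k + 2) a
      rcases eq_or_eq_of_ne ha with rfl | rfl <;> omega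
  rw [weight, pairCost, if_neg (h 0), if_neg (h 1), if_neg (h 2)]

/-! ### The cost of a labelling as a sum over cells -/

/-- Indicator that the edge opposite to `up x k` in the cell `x` is cut. -/
noncomputable def cutInd {m : ℕ} (Q : Node (m + 1) → Fin 4) (x : Node m) (k : Fin 3) : ℝ :=
  if Q (up x (k + 1)) = Q (up x (k + 2)) then 0 else 1

theorem cutInd_nonneg {m : ℕ} (Q : Node (m + 1) → Fin 4) (x : Node m) (k : Fin 3) :
    0 ≤ cutInd Q x k := by
  unfold cutInd
  split_ifs <;> norm_num

/-- The cost of the cut edges of the cell `x`. -/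
noncomputable def cellCost {m : ℕ} (Q : Node (m + 1) → Fin 4) (x : Node m) : ℝ :=
  ∑ k, weight x k * cutInd Q x k

theorem cellCost_nonneg {m : ℕ} (Q : Node (m + 1) → Fin 4) (x : Node m) : 0 ≤ cellCost Q x :=
  Finset.sum_nonneg fun _ _ => mul_nonneg (weight_nonneg _ _) (cutInd_nonneg _ _ _)

/-- The cost of the cut edges, collected over all cells. -/
noncomputable def totalCost {m : ℕ} (Q : Node (m + 1) → Fin 4) : ℝ := ∑ x, cellCost Q x

theorem graph_adj_up {m : ℕ} (x : Node m) {i j : Fin 3} (h : i ≠ j) :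
    (graph (m + 1)).Adj (up x i) (up x j) := by
  refine ⟨up_ne_up x h, ?_⟩
  have hp : (0 : ℝ) < (m : ℝ) + 1 := by positivity
  have key : ∀ l, |(up x i).pt l - (up x j).pt l|
      = (if l = i then 1 / ((m : ℝ) + 1) else 0) + if l = j then 1 / ((m : ℝ) + 1) else 0 := by
    intro l
    simp only [pt_div, up_apply]
    rw [div_sub_div_same, abs_div, abs_of_pos (show (0 : ℝ) < ((m + 1 : ℕ) : ℝ) by positivity)]
    by_cases h1 : l = i
    · have h2 : l ≠ j := fun e => h (h1.symm.trans e)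
      simp [h1, h]
    · by_cases h2 : l = j
      · simp [h2, h.symm]
      · simp [h1, h2]
  rw [Finset.sum_congr rfl fun l _ => key l, Finset.sum_add_distrib]
  simp only [Finset.sum_ite_eq', Finset.mem_univ, if_true]
  push_cast
  ring

/-- The coordinatewise minimum of the two ends of an edge is the index of its cell, so no edge is
counted twice in `totalCost`. -/
theorem up_pair_injective {m : ℕ} : Function.Injective
    (fun p : Node m × Fin 3 => s(up p.1 (p.2 + 1), up p.1 (p.2 + 2))) := by
  rintro ⟨x, k⟩ ⟨y, l⟩ h
  simp only [Sym2.eq_iff] at h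
  have hx : ∀ z : Node m, ∀ k i, z.1 i = min ((up z (k + 1)).1 i) ((up z (k + 2)).1 i) := by
    intro z k i
    rw [up_apply, up_apply]
    have := add_one_ne_add_two k
    split_ifs with h1 h2
    · exact absurd (h1.symm.trans h2) this
    all_goals omega
  have hxy : x = y := by
    apply Subtype.ext
    funext i
    rw [hx x k i, hx y l i]
    rcases h with ⟨h1, h2⟩ | ⟨h1, h2⟩
    · rw [h1, h2]
    · rw [h1, h2, min_comm]
  subst hxy
  have hinj : ∀ i j, up x i = up x j → i = j := by
    intro i j e
    by_contra hne
    exact up_ne_up x hne e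
  have hkl : k = l := by
    rcases h with ⟨h1, -⟩ | ⟨h1, h2⟩
    · exact add_right_cancel (hinj _ _ h1)
    · replace h1 := hinj _ _ h1
      replace h2 := hinj _ _ h2
      clear hinj hx
      revert k l
      decide
  rw [hkl]

open Classical in
theorem totalCost_le_costJ {m : ℕ} (Q : Node (m + 1) → Fin 4) :
    totalCost Q ≤ costJ (m + 1) (cutSet Q) := by
  set f : Node m × Fin 3 → Sym2 (Node (m + 1)) :=
    fun p => s(up p.1 (p.2 + 1), up p.1 (p.2 + 2)) with hf
  set S : Finset (Node m × Fin 3) :=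
    Finset.univ.filter fun p => Q (up p.1 (p.2 + 1)) ≠ Q (up p.1 (p.2 + 2)) with hS
  have h1 : totalCost Q = ∑ p ∈ S, edgeCost (m + 1) (f p) := by
    rw [hS, Finset.sum_filter, totalCost, Fintype.sum_prod_type]
    refine Finset.sum_congr rfl fun x _ => Finset.sum_congr rfl fun k _ => ?_
    rw [cutInd]
    by_cases h : Q (up x (k + 1)) = Q (up x (k + 2))
    · simp [h]
    · simp [h, hf, edgeCost, weight]
  rw [h1, ← Finset.sum_image (s := S) (g := f) (f := edgeCost (m + 1))
    (fun _ _ _ _ e => up_pair_injective e), costJ]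
  apply Finset.sum_le_sum_of_subset_of_nonneg
  · intro e he
    obtain ⟨p, hp, rfl⟩ := Finset.mem_image.1 he
    rw [Finset.mem_filter]
    exact ⟨Finset.mem_univ _, _, _, graph_adj_up p.1 (add_one_ne_add_two p.2),
      (Finset.mem_filter.1 hp).2, rfl⟩
  · intro e _ _
    induction e with
    | _ u v => exact pairCost_nonneg _ _ _

/-! ### Walking along a line until the label changes -/

/-- Moving from `v` by steps that trade a unit of coordinate `p` for one of `q`, the walk ends at a
node labelled `l`, so some step changes the label. The bounds on `x.1 p` locate that step between
the end and `v`. -/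
theorem exists_cut_on_line {m : ℕ} (Q : Node (m + 1) → Fin 4) {p q r : Fin 3} (hpq : p ≠ q)
    (hrp : r ≠ p) (hrq : r ≠ q) (τ s : ℕ) (l : Fin 4)
    (h : ∀ u : Node (m + 1), u.1 p = τ → u.1 r = s → Q u = l) (v : Node (m + 1))
    (hv : τ ≤ v.1 p) (hvr : v.1 r = s) (hl : Q v ≠ l) :
    ∃ x : Node m, x.1 r = s ∧ τ ≤ x.1 p ∧ x.1 p < v.1 p ∧ Q (up x p) ≠ Q (up x q) := by
  obtain ⟨d, hd⟩ := Nat.exists_eq_add_of_le hv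
  induction d generalizing v with
  | zero => exact absurd (h v hd hvr) hl
  | succ d ih =>
    obtain ⟨x, rfl⟩ := exists_up v p (by omega)
    have hp : (up x q).1 p = x.1 p := up_of_ne x hpq
    have hr : (up x q).1 r = x.1 r := up_of_ne x hrq
    rw [up_self] at hd hv
    rw [up_of_ne x hrp] at hvr
    by_cases hQ : Q (up x p) = Q (up x q)
    · obtain ⟨y, h1, h2, h3, h4⟩ := ih (up x q) (by omega) (by omega) (hQ ▸ hl) (by omega)
      exact ⟨y, h1, h2, by rw [up_self]; omega, h4⟩
    · exact ⟨x, hvr, by omega, by rw [up_self]; omega, hQ⟩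

theorem cutInd_congr {m : ℕ} {Q Q' : Node (m + 1) → Fin 4} {x : Node m}
    (h : ∀ j, Q (up x j) = Q' (up x j)) (k : Fin 3) : cutInd Q x k = cutInd Q' x k := by
  simp only [cutInd, h]

theorem cellCost_congr {m : ℕ} {Q Q' : Node (m + 1) → Fin 4} {x : Node m}
    (h : ∀ j, Q (up x j) = Q' (up x j)) : cellCost Q x = cellCost Q' x := by
  simp only [cellCost, cutInd_congr h]

theorem cutInd_eq_zero {m : ℕ} {Q : Node (m + 1) → Fin 4} {x : Node m} {k : Fin 3}
    (h : Q (up x (k + 1)) = Q (up x (k + 2))) : cutInd Q x k = 0 := if_pos h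

theorem cutInd_eq_one {m : ℕ} {Q : Node (m + 1) → Fin 4} {x : Node m} {k : Fin 3}
    (h : Q (up x (k + 1)) ≠ Q (up x (k + 2))) : cutInd Q x k = 1 := if_neg h

/-! ### Removing islands from red triangles -/

/-- Relabel all nodes with `a`-th coordinate at least `t` by `a`. -/
def fillCorner {n : ℕ} (a : Fin 3) (t : ℕ) (Q : Node n → Fin 4) : Node n → Fin 4 :=
  fun v => if t ≤ v.1 a then a.castSucc else Q v

theorem fillCorner_of_le {n : ℕ} {a : Fin 3} {t : ℕ} {Q : Node n → Fin 4} {v : Node n}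
    (h : t ≤ v.1 a) : fillCorner a t Q v = a.castSucc := if_pos h

theorem fillCorner_of_lt {n : ℕ} {a : Fin 3} {t : ℕ} {Q : Node n → Fin 4} {v : Node n}
    (h : v.1 a < t) : fillCorner a t Q v = Q v := if_neg (not_le.2 h)

theorem weight_of_large {m : ℕ} (hm : 9 ≤ m) (x : Node m) {a k : Fin 3} (hk : a ≠ k)
    (ha : m < 2 * x.1 a) (h0 : x.1 k ≠ 0) : weight x k = rho (m + 1) := by
  by_cases h : 2 * (m + 1) < 3 * (x.1 a + 1)
  · rw [weight_of_corner hm x hk h, if_neg h0]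
  · have hs := x.sum_eq k
    apply weight_of_center
    all_goals rcases eq_or_eq_of_ne hk with rfl | rfl <;> omega

-- Each line on which coordinate `a + 1` is constant and which meets the island also reaches row
-- `t`, where the label is `a`; hence it contains a cut edge. Distinct lines give distinct cells,
-- and a line carries at most `m + 1` island nodes.
open Classical in
theorem card_island_le {m : ℕ} (Q : Node (m + 1) → Fin 4) (a : Fin 3) (t : ℕ) (ht : 0 < t)
    (hrow : ∀ v : Node (m + 1), v.1 a = t → Q v = a.castSucc)
    (hside : ∀ v : Node (m + 1), t ≤ v.1 a → v.1 (a + 1) = 0 → Q v = a.castSucc) :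
    (Finset.univ.filter fun v : Node (m + 1) => t ≤ v.1 a ∧ Q v = Fin.last 3).card ≤
      (m + 1) * (Finset.univ.filter fun x : Node m =>
        t ≤ x.1 a ∧ x.1 (a + 1) ≠ 0 ∧ Q (up x (a + 1 + 1)) ≠ Q (up x (a + 1 + 2))).card := by
  set A := Finset.univ.filter fun v : Node (m + 1) => t ≤ v.1 a ∧ Q v = Fin.last 3
  set C := Finset.univ.filter fun x : Node m =>
    t ≤ x.1 a ∧ x.1 (a + 1) ≠ 0 ∧ Q (up x (a + 1 + 1)) ≠ Q (up x (a + 1 + 2))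
  have hex : ∀ v ∈ A, ∃ x ∈ C, x.1 (a + 1) = v.1 (a + 1) := by
    intro v hv
    obtain ⟨hv1, hv2⟩ := (Finset.mem_filter.1 hv).2
    have hne : Q v ≠ a.castSucc := by
      rw [hv2]
      exact (Fin.castSucc_lt_last a).ne'
    obtain ⟨x, h1, h2, h3, h4⟩ := exists_cut_on_line Q (ne_add_two a) (ne_add_one a).symm
      (add_one_ne_add_two a) t (v.1 (a + 1)) a.castSucc (fun u hu _ => hrow u hu) v hv1 rfl hne
    refine ⟨x, Finset.mem_filter.2 ⟨Finset.mem_univ _, h2, ?_, ?_⟩, h1⟩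
    · intro h0
      exact hne (hside v hv1 (by omega))
    · rw [add_one_add_one, add_one_add_two]
      exact h4.symm
  have hcoord : A.card = ∑ x ∈ C.image (fun x => x.1 (a + 1)),
      (A.filter fun v => v.1 (a + 1) = x).card := by
    apply Finset.card_eq_sum_card_fiberwise
    intro v hv
    obtain ⟨x, hx, hxv⟩ := hex v hv
    exact Finset.mem_coe.2 (Finset.mem_image.2 ⟨x, hx, hxv⟩)
  have hfib : ∀ s, (A.filter fun v => v.1 (a + 1) = s).card ≤ m + 1 := by
    intro s
    have hle : (A.filter fun v => v.1 (a + 1) = s).card ≤ (Finset.Icc 1 (m + 1)).card := by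
      apply Finset.card_le_card_of_injOn (fun v => v.1 a)
      · intro v hv
        have hv := (Finset.mem_filter.1 (Finset.mem_filter.1 hv).1).2.1
        have := v.add_le (ne_add_one a)
        simp only [Finset.coe_Icc, Set.mem_Icc]
        omega
      · intro u hu v hv huv
        have h1 := (Finset.mem_filter.1 hu).2
        have h2 := (Finset.mem_filter.1 hv).2
        exact Node.ext_of_two (ne_add_one a) huv (h1.trans h2.symm)
    simpa using hle
  calc A.card ≤ ∑ x ∈ C.image (fun x => x.1 (a + 1)), (m + 1) := by
        rw [hcoord]
        exact Finset.sum_le_sum fun s _ => hfib s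
    _ = (C.image fun x => x.1 (a + 1)).card * (m + 1) := by rw [Finset.sum_const, smul_eq_mul]
    _ ≤ C.card * (m + 1) := Nat.mul_le_mul_right _ Finset.card_image_le
    _ = _ := mul_comm _ _

open Classical in
theorem totalCost_fillCorner_add_le {m : ℕ} (hm : 9 ≤ m) (Q : Node (m + 1) → Fin 4) (a : Fin 3)
    (t : ℕ) (ht : m + 1 < 2 * t)
    (hrow : ∀ v : Node (m + 1), v.1 a = t → Q v = a.castSucc)
    (hside : ∀ v : Node (m + 1), t ≤ v.1 a → v.1 (a + 1) = 0 → Q v = a.castSucc) :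
    totalCost (fillCorner a t Q) + 0.4 * ((Finset.univ.filter fun v : Node (m + 1) =>
      t ≤ v.1 a ∧ Q v = Fin.last 3).card : ℝ) / ((m : ℝ) + 1) ^ 2 ≤ totalCost Q := by
  have hcard := card_island_le Q a t (by omega) hrow hside
  set A := Finset.univ.filter fun v : Node (m + 1) => t ≤ v.1 a ∧ Q v = Fin.last 3
  set P : Node m → Prop := fun x =>
    t ≤ x.1 a ∧ x.1 (a + 1) ≠ 0 ∧ Q (up x (a + 1 + 1)) ≠ Q (up x (a + 1 + 2)) with hP
  have hcell : ∀ x, cellCost (fillCorner a t Q) x + (if P x then rho (m + 1) else 0)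
      ≤ cellCost Q x := by
    intro x
    by_cases hx : t ≤ x.1 a
    · have hfill : ∀ j, fillCorner a t Q (up x j) = a.castSucc := fun j =>
        fillCorner_of_le (hx.trans (le_up x j a))
      have h0 : cellCost (fillCorner a t Q) x = 0 :=
        Finset.sum_eq_zero fun k _ => by rw [cutInd_eq_zero (by rw [hfill, hfill]), mul_zero]
      rw [h0, zero_add]
      split_ifs with h
      · have hw := weight_of_large hm x (ne_add_one a) (by omega) h.2.1
        have hle := Finset.single_le_sum (f := fun k => weight x k * cutInd Q x k)
          (fun k _ => mul_nonneg (weight_nonneg x k) (cutInd_nonneg Q x k))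
          (Finset.mem_univ (a + 1))
        simp only [hw, cutInd_eq_one h.2.2, mul_one] at hle
        exact hle
      · exact cellCost_nonneg Q x
    -- A cell below row `t` can only touch the filled region in row `t`, which has label `a`
    -- already.
    · rw [if_neg fun h => hx h.1, add_zero]
      apply le_of_eq
      apply cellCost_congr
      intro j
      by_cases hj : t ≤ (up x j).1 a
      · rw [fillCorner_of_le hj, hrow _ (le_antisymm _ hj)]
        have := up_le x j a
        omega
      · exact fillCorner_of_lt (not_le.1 hj)
  have hsum := Finset.sum_le_sum fun (x : Node m) (_ : x ∈ Finset.univ) => hcell x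
  rw [Finset.sum_add_distrib, ← Finset.sum_filter, Finset.sum_const, nsmul_eq_mul] at hsum
  refine le_trans (add_le_add le_rfl ?_) hsum
  have hcard' : (A.card : ℝ) ≤ ((m : ℝ) + 1) * ((Finset.univ.filter P).card : ℝ) := by
    exact_mod_cast hcard
  have hc0 : (0 : ℝ) ≤ ((Finset.univ.filter P).card : ℝ) := Nat.cast_nonneg _
  have hmp : (0 : ℝ) < (m : ℝ) + 1 := by positivity
  rw [rho]
  push_cast
  rw [mul_div_assoc', div_le_div_iff₀ (by positivity) (by positivity)]
  -- The saving is `3/5` per island node after division by `n²`, so `0.4` leaves slack.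
  nlinarith [mul_le_mul_of_nonneg_left hcard' hmp.le, mul_nonneg hc0 (mul_pos hmp hmp).le]

/-! ### Filling the expensive corners -/

theorem sum_ite_up {m : ℕ} (x₀ : Node m) (j : Fin 3) (g : Node m → ℝ) :
    ∑ x, (if up x j = up x₀ j then g x else 0) = g x₀ := by
  rw [Finset.sum_eq_single x₀]
  · rw [if_pos rfl]
  · intro x _ hx
    exact if_neg fun h => hx (up_injective j h)
  · intro h
    exact absurd (Finset.mem_univ _) h

theorem sum_ite_up_of_eq_zero {m : ℕ} {v : Node (m + 1)} {j : Fin 3} (hv : v.1 j = 0)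
    (g : Node m → ℝ) : ∑ x, (if up x j = v then g x else 0) = 0 := by
  apply Finset.sum_eq_zero
  intro x _
  apply if_neg
  rintro rfl
  rw [up_self] at hv
  omega

theorem cellCost_eq {m : ℕ} (Q : Node (m + 1) → Fin 4) (x : Node m) (a : Fin 3) :
    cellCost Q x = weight x a * (if Q (up x (a + 1)) = Q (up x (a + 2)) then 0 else 1)
      + weight x (a + 1) * (if Q (up x (a + 2)) = Q (up x a) then 0 else 1)
      + weight x (a + 2) * (if Q (up x a) = Q (up x (a + 1)) then 0 else 1) := by
  rw [cellCost, sum_fin_three _ a]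
  simp only [cutInd, add_one_add_one, add_one_add_two, add_two_add_one, add_two_add_two]

/-- Relabelling `v` can newly cut only the edges going down from `v`, as parallel ones are free, and
it repairs those going up. Inside, this trades at most `2ρ` for `2ρ`. On a side there is only one
upward edge, but it costs exactly `ρ` more than the boundary edge below it, which pays for the inner
downward edge. -/
theorem totalCost_update_le {m : ℕ} (hm : 9 ≤ m) (Q : Node (m + 1) → Fin 4) (a : Fin 3)
    (v : Node (m + 1)) (hv : 2 * (m + 1) < 3 * v.1 a) (hvm : v.1 a ≤ m)
    (habove : ∀ u : Node (m + 1), v.1 a < u.1 a → Q u = a.castSucc) (hQv : Q v ≠ a.castSucc) :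
    totalCost (Function.update Q v a.castSucc) ≤ totalCost Q := by
  have hab := ne_add_one a
  have hac := ne_add_two a
  have hbc := add_one_ne_add_two a
  have hcell : ∀ x, cellCost (Function.update Q v a.castSucc) x +
      -- The three cells at `v`: the one below it, which may lose, and the two beside it, which gain
      -- their edge to the row above.
      ((if up x a = v then -(weight x (a + 1) + weight x (a + 2)) else 0)
        + (if up x (a + 1) = v then weight x (a + 2) else 0)
        + (if up x (a + 2) = v then weight x (a + 1) else 0)) ≤ cellCost Q x := by
    intro x
    have hwb := weight_nonneg x (a + 1)
    have hwc := weight_nonneg x (a + 2)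
    by_cases ha : up x a = v
    · have hb : up x (a + 1) ≠ v := ha ▸ up_ne_up x hab.symm
      have hc : up x (a + 2) ≠ v := ha ▸ up_ne_up x hac.symm
      rw [if_pos ha, if_neg hb, if_neg hc, cellCost_eq Q x a,
        cellCost_eq (Function.update Q v a.castSucc) x a]
      simp only [Function.update_of_ne hb, Function.update_of_ne hc]
      have h1 : ∀ (c : Prop) [Decidable c], (0 : ℝ) ≤ (if c then 0 else 1) := by
        intro c _
        split_ifs <;> norm_num
      have h2 : ∀ (c : Prop) [Decidable c], (if c then 0 else 1) ≤ (1 : ℝ) := by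
        intro c _
        split_ifs <;> norm_num
      have e1 := mul_le_mul_of_nonneg_left (h2 (Q (up x (a + 2)) =
        Function.update Q v a.castSucc (up x a))) hwb
      have e2 := mul_le_mul_of_nonneg_left (h2 (Function.update Q v a.castSucc (up x a) =
        Q (up x (a + 1)))) hwc
      have e3 := mul_nonneg hwb (h1 (Q (up x (a + 2)) = Q (up x a)))
      have e4 := mul_nonneg hwc (h1 (Q (up x a) = Q (up x (a + 1))))
      linarith
    by_cases hb : up x (a + 1) = v
    · have hc : up x (a + 2) ≠ v := hb ▸ up_ne_up x hbc.symm
      have hxa : x.1 a = v.1 a := by rw [← hb, up_of_ne x hab]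
      have hQa : Q (up x a) = a.castSucc := habove _ (by rw [up_self]; omega)
      rw [if_neg ha, if_pos hb, if_neg hc, cellCost_eq Q x a,
        cellCost_eq (Function.update Q v a.castSucc) x a,
        weight_of_corner_parallel hm x a (by omega)]
      simp only [hb, Function.update_of_ne ha, Function.update_of_ne hc, Function.update_self, hQa,
        if_neg (Ne.symm hQv)]
      apply le_of_eq
      simp
    by_cases hc : up x (a + 2) = v
    · have hxa : x.1 a = v.1 a := by rw [← hc, up_of_ne x hac]
      have hQa : Q (up x a) = a.castSucc := habove _ (by rw [up_self]; omega)
      rw [if_neg ha, if_neg hb, if_pos hc, cellCost_eq Q x a,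
        cellCost_eq (Function.update Q v a.castSucc) x a,
        weight_of_corner_parallel hm x a (by omega)]
      simp only [hc, Function.update_of_ne ha, Function.update_of_ne hb, Function.update_self, hQa,
        if_neg hQv]
      apply le_of_eq
      simp
      ring
    · rw [if_neg ha, if_neg hb, if_neg hc]
      apply le_of_eq
      simp only [add_zero]
      apply cellCost_congr
      intro j
      apply Function.update_of_ne
      by_cases hj : j = a
      · rwa [hj]
      · rcases eq_or_eq_of_ne hj with rfl | rfl <;> assumption
  have hsum := Finset.sum_le_sum fun (x : Node m) (_ : x ∈ Finset.univ) => hcell x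
  simp only [Finset.sum_add_distrib] at hsum
  obtain ⟨x, hx⟩ := exists_up v a (by omega)
  have hxa : x.1 a + 1 = v.1 a := by rw [← hx, up_self]
  have hxb : x.1 (a + 1) = v.1 (a + 1) := by rw [← hx, up_of_ne x hab.symm]
  have hxc : x.1 (a + 2) = v.1 (a + 2) := by rw [← hx, up_of_ne x hac.symm]
  have hvs := v.sum_eq a
  have hsa : ∑ y, (if up y a = v then -(weight y (a + 1) + weight y (a + 2)) else 0)
      = -(weight x (a + 1) + weight x (a + 2)) := by
    rw [← hx]
    exact sum_ite_up x a fun y => -(weight y (a + 1) + weight y (a + 2))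
  rw [hsa, weight_of_corner hm x hab (by omega), weight_of_corner hm x hac (by omega)] at hsum
  have hr := (rho_pos (Nat.succ_pos m)).le
  have hcast : (v.1 a : ℝ) = x.1 a + 1 := by exact_mod_cast hxa.symm
  have hsb : v.1 (a + 1) ≠ 0 → ∑ y, (if up y (a + 1) = v then weight y (a + 2) else 0)
      = if v.1 (a + 2) = 0 then ((x.1 a : ℝ) + 2 - 2 * ((m : ℝ) + 1) / 3) * rho (m + 1)
        else rho (m + 1) := by
    intro h
    obtain ⟨y, hy⟩ := exists_up v (a + 1) (by omega)
    have hya : y.1 a = v.1 a := by rw [← hy, up_of_ne y hab]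
    have hyc : y.1 (a + 2) = v.1 (a + 2) := by rw [← hy, up_of_ne y hbc.symm]
    have := sum_ite_up y (a + 1) fun y => weight y (a + 2)
    rw [hy, weight_of_corner hm y hac (by omega), hya, hyc, hcast] at this
    rw [this]
    congr 2
    ring
  have hsc : v.1 (a + 2) ≠ 0 → ∑ y, (if up y (a + 2) = v then weight y (a + 1) else 0)
      = if v.1 (a + 1) = 0 then ((x.1 a : ℝ) + 2 - 2 * ((m : ℝ) + 1) / 3) * rho (m + 1)
        else rho (m + 1) := by
    intro h
    obtain ⟨y, hy⟩ := exists_up v (a + 2) (by omega)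
    have hya : y.1 a = v.1 a := by rw [← hy, up_of_ne y hac]
    have hyb : y.1 (a + 1) = v.1 (a + 1) := by rw [← hy, up_of_ne y hbc]
    have := sum_ite_up y (a + 2) fun y => weight y (a + 1)
    rw [hy, weight_of_corner hm y hab (by omega), hya, hyb, hcast] at this
    rw [this]
    congr 2
    ring
  rw [hxb, hxc] at hsum
  unfold totalCost
  by_cases hb : v.1 (a + 1) = 0
  · have hc : v.1 (a + 2) ≠ 0 := by omega
    rw [sum_ite_up_of_eq_zero hb, hsc hc, if_pos hb, if_pos hb, if_neg hc] at hsum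
    linarith
  · by_cases hc : v.1 (a + 2) = 0
    · rw [sum_ite_up_of_eq_zero hc, hsb hb, if_pos hc, if_pos hc, if_neg hb] at hsum
      linarith
    · rw [hsb hb, hsc hc, if_neg hb, if_neg hb, if_neg hc, if_neg hc] at hsum
      linarith

open Classical in
theorem exists_filled_corner {m : ℕ} (hm : 9 ≤ m) (a : Fin 3) (Q : Node (m + 1) → Fin 4)
    (hQ : Q (terminal (m + 1) a) = a.castSucc) :
    ∃ Q' : Node (m + 1) → Fin 4,
      (∀ v : Node (m + 1), 2 * (m + 1) < 3 * v.1 a → Q' v = a.castSucc) ∧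
      (∀ v : Node (m + 1), ¬ 2 * (m + 1) < 3 * v.1 a → Q' v = Q v) ∧
      totalCost Q' ≤ totalCost Q := by
  obtain ⟨N, hN⟩ : ∃ N, (Finset.univ.filter fun v : Node (m + 1) =>
    2 * (m + 1) < 3 * v.1 a ∧ Q v ≠ a.castSucc).card = N := ⟨_, rfl⟩
  induction N generalizing Q with
  | zero =>
    refine ⟨Q, ?_, fun _ _ => rfl, le_rfl⟩
    intro v hv
    by_contra h
    have : v ∈ (∅ : Finset (Node (m + 1))) := by
      rw [← Finset.card_eq_zero.1 hN, Finset.mem_filter]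
      exact ⟨Finset.mem_univ _, hv, h⟩
    simp at this
  | succ N ih =>
    have hpos : 0 < (Finset.univ.filter fun v : Node (m + 1) =>
        2 * (m + 1) < 3 * v.1 a ∧ Q v ≠ a.castSucc).card := by omega
    -- A wrongly labelled node nearest to `e^a`, so that all rows above it are already filled.
    obtain ⟨v, hv, hmax⟩ := Finset.exists_max_image _ (fun v : Node (m + 1) => v.1 a)
      (Finset.card_pos.1 hpos)
    obtain ⟨hv1, hv2⟩ := (Finset.mem_filter.1 hv).2
    have hvt : v ≠ terminal (m + 1) a := by
      rintro rfl
      exact hv2 hQ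
    have hvm : v.1 a ≤ m := by
      by_contra h
      have hs := v.sum_eq a
      apply hvt
      apply Node.ext_of_two (ne_add_one a)
      · simp only [terminal, Pi.single_eq_same]
        omega
      · simp only [terminal, Pi.single_eq_of_ne (ne_add_one a).symm]
        omega
    have habove : ∀ u : Node (m + 1), v.1 a < u.1 a → Q u = a.castSucc := by
      intro u hu
      by_contra h
      have := hmax u (Finset.mem_filter.2 ⟨Finset.mem_univ _, by omega, h⟩)
      omega
    have hcost := totalCost_update_le hm Q a v hv1 hvm habove hv2
    obtain ⟨Q', h1, h2, h3⟩ := ih (Function.update Q v a.castSucc)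
      (by rw [Function.update_of_ne hvt.symm, hQ]) (by
        have he : (Finset.univ.filter fun u : Node (m + 1) => 2 * (m + 1) < 3 * u.1 a ∧
            Function.update Q v a.castSucc u ≠ a.castSucc) =
            (Finset.univ.filter fun u : Node (m + 1) =>
              2 * (m + 1) < 3 * u.1 a ∧ Q u ≠ a.castSucc).erase v := by
          ext u
          simp only [Finset.mem_filter, Finset.mem_univ, true_and, Finset.mem_erase]
          by_cases hu : u = v
          · subst hu
            simp
          · simp [hu]
        rw [he, Finset.card_erase_of_mem hv, hN]
        rfl)
    refine ⟨Q', h1, ?_, h3.trans hcost⟩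
    intro u hu
    rw [h2 u hu, Function.update_of_ne]
    rintro rfl
    exact hu hv1

/-! ### Counting cut edges -/

/-- Two nodes in a common cell with the same label. -/
def SameStep {m : ℕ} (Q : Node (m + 1) → Fin 4) (u v : Node (m + 1)) : Prop :=
  Q u = Q v ∧ ∃ (x : Node m) (i j : Fin 3), u = up x i ∧ v = up x j

theorem SameStep.symm {m : ℕ} {Q : Node (m + 1) → Fin 4} {u v : Node (m + 1)}
    (h : SameStep Q u v) : SameStep Q v u := by
  obtain ⟨h1, x, i, j, h2, h3⟩ := h
  exact ⟨h1.symm, x, j, i, h3, h2⟩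

/-- Two nodes in the same connected component of a colour class. -/
abbrev SameComp {m : ℕ} (Q : Node (m + 1) → Fin 4) : Node (m + 1) → Node (m + 1) → Prop :=
  Relation.ReflTransGen (SameStep Q)

theorem SameComp.symm {m : ℕ} {Q : Node (m + 1) → Fin 4} {u v : Node (m + 1)}
    (h : SameComp Q u v) : SameComp Q v u := by
  induction h with
  | refl => exact Relation.ReflTransGen.refl
  | tail _ h ih => exact ih.head h.symm

theorem SameComp.label_eq {m : ℕ} {Q : Node (m + 1) → Fin 4} {u v : Node (m + 1)}
    (h : SameComp Q u v) : Q u = Q v := by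
  induction h with
  | refl => rfl
  | tail _ h ih => exact ih.trans h.1

/-- Discrete intermediate value property: one step changes a coordinate by at most one. -/
theorem SameComp.exists_coord_eq {m : ℕ} {Q : Node (m + 1) → Fin 4} {u w : Node (m + 1)}
    (h : SameComp Q u w) (a : Fin 3) (j : ℕ) (hu : u.1 a ≤ j) (hw : j ≤ w.1 a) :
    ∃ v, SameComp Q u v ∧ v.1 a = j := by
  induction h with
  | refl => exact ⟨u, Relation.ReflTransGen.refl, le_antisymm hu hw⟩
  | @tail b c hb hc ih =>
    by_cases hj : j ≤ b.1 a
    · exact ih hj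
    · obtain ⟨-, x, i, k, rfl, rfl⟩ := id hc
      have h1 := le_up x i a
      have h2 := up_le x k a
      exact ⟨_, hb.tail hc, by omega⟩

/-- The indicator `cutInd` with values in `ℕ`. -/
noncomputable def cutNum {m : ℕ} (Q : Node (m + 1) → Fin 4) (x : Node m) (k : Fin 3) : ℕ :=
  if Q (up x (k + 1)) = Q (up x (k + 2)) then 0 else 1

theorem cutNum_eq_one {m : ℕ} {Q : Node (m + 1) → Fin 4} {x : Node m} {k : Fin 3}
    (h : Q (up x (k + 1)) ≠ Q (up x (k + 2))) : cutNum Q x k = 1 := if_neg h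

/-! ### A component meeting all three sides -/

theorem two_le_line {m : ℕ} (Q : Node (m + 1) → Fin 4)
    (hcorner : ∀ (a : Fin 3) (v : Node (m + 1)), 2 * (m + 1) < 3 * v.1 a → Q v = a.castSucc)
    (a : Fin 3) (v : Node (m + 1)) (hv : 3 * v.1 a < m + 1) (hQ : Q v = Fin.last 3) :
    2 ≤ ∑ x : Node m, if x.1 a = v.1 a then cutNum Q x a else 0 := by
  have hne : ∀ b : Fin 3, Q v ≠ b.castSucc := by
    intro b
    rw [hQ]
    exact (Fin.castSucc_lt_last b).ne'
  obtain ⟨x, hx1, -, hx3, hx4⟩ := exists_cut_on_line Q (add_one_ne_add_two a) (ne_add_one a)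
    (ne_add_two a) 0 (v.1 a) (a + 2).castSucc (fun u h1 h2 => hcorner _ _ (by
      have := u.sum_eq a
      omega)) v (Nat.zero_le _) rfl (hne _)
  obtain ⟨y, hy1, -, hy3, hy4⟩ := exists_cut_on_line Q (add_one_ne_add_two a).symm (ne_add_two a)
    (ne_add_one a) 0 (v.1 a) (a + 1).castSucc (fun u h1 h2 => hcorner _ _ (by
      have := u.sum_eq a
      omega)) v (Nat.zero_le _) rfl (hne _)
  -- The two walks leave `v` in opposite directions; a common cell would have coordinate sum at most
  -- `m - 1`.
  have hxy : x ≠ y := by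
    rintro rfl
    have := x.sum_eq a
    have := v.sum_eq a
    omega
  have hle := Finset.add_le_sum (f := fun x : Node m => if x.1 a = v.1 a then cutNum Q x a else 0)
    (fun i _ => Nat.zero_le _) (Finset.mem_univ x) (Finset.mem_univ y) hxy
  simp only [if_pos hx1, if_pos hy1, cutNum_eq_one hx4, cutNum_eq_one hy4.symm] at hle
  exact hle

theorem le_cuts_of_spanning {m : ℕ} (Q : Node (m + 1) → Fin 4)
    (hno : ∀ (v : Node (m + 1)) (i : Fin 3), Q v = i.castSucc → 0 < v.1 i)
    (hcorner : ∀ (a : Fin 3) (v : Node (m + 1)), 2 * (m + 1) < 3 * v.1 a → Q v = a.castSucc)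
    (v₀ : Node (m + 1)) (h : ∀ i : Fin 3, ∃ u, SameComp Q v₀ u ∧ u.1 i = 0) :
    2 * (m + 1) ≤ ∑ x : Node m, ∑ k, cutNum Q x k := by
  choose w hw hw0 using h
  have hlab : Q v₀ = Fin.last 3 := by
    by_contra hl
    obtain ⟨i, hi⟩ := Fin.exists_castSucc_eq.2 hl
    have := hno (w i) i (by rw [← (hw i).label_eq, hi])
    have := hw0 i
    omega
  have hline : ∀ (a : Fin 3) (j : ℕ), 3 * j < m + 1 →
      2 ≤ ∑ x : Node m, if x.1 a = j then cutNum Q x a else 0 := by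
    intro a j hj
    -- On the side where coordinate `a + 1` vanishes, the component avoids the corner `a + 2`, so
    -- its coordinate `a` there is at least `n/3`. Together with a node at height `0` this makes the
    -- component cross every line below `n/3`.
    have hc : ¬ 2 * (m + 1) < 3 * (w (a + 1)).1 (a + 2) := by
      intro hlt
      have := hcorner _ _ hlt
      rw [← (hw (a + 1)).label_eq, hlab] at this
      exact (Fin.castSucc_lt_last (a + 2)).ne' this
    have hs := (w (a + 1)).sum_eq a
    have h0 := hw0 (a + 1)
    obtain ⟨v, hv, hvj⟩ := SameComp.exists_coord_eq ((hw a).symm.trans (hw (a + 1))) a j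
      (by rw [hw0]; exact Nat.zero_le _) (by omega)
    subst hvj
    exact two_le_line Q hcorner a v hj (by rw [← hv.label_eq, ← (hw a).label_eq, hlab])
  -- There are `m / 3 + 1 = ⌈n/3⌉` heights `j` with `3j < n`.
  have hdir : ∀ a : Fin 3, 2 * (m / 3 + 1) ≤ ∑ x : Node m, cutNum Q x a := by
    intro a
    calc 2 * (m / 3 + 1) = ∑ j ∈ Finset.range (m / 3 + 1), 2 := by
          rw [Finset.sum_const, Finset.card_range, smul_eq_mul, mul_comm]
      _ ≤ ∑ j ∈ Finset.range (m / 3 + 1), ∑ x : Node m, if x.1 a = j then cutNum Q x a else 0 :=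
          Finset.sum_le_sum fun j hj => hline a j (by
            have := Finset.mem_range.1 hj
            omega)
      _ = ∑ x : Node m, ∑ j ∈ Finset.range (m / 3 + 1), if x.1 a = j then cutNum Q x a else 0 :=
          Finset.sum_comm
      _ ≤ _ := Finset.sum_le_sum fun x _ => by
          rw [Finset.sum_ite_eq]
          split_ifs <;> omega
  rw [Finset.sum_comm, Fin.sum_univ_three]
  have h0 := hdir 0
  have h1 := hdir 1
  have h2 := hdir 2
  omega

/-! ### Components that each miss a side -/

/-- All three vertices of the cell `x` have the same label. -/
def Mono {m : ℕ} (Q : Node (m + 1) → Fin 4) (x : Node m) : Prop :=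
  ∀ i j : Fin 3, Q (up x i) = Q (up x j)

theorem Mono.sameComp {m : ℕ} {Q : Node (m + 1) → Fin 4} {x : Node m} (h : Mono Q x)
    (i j : Fin 3) : SameComp Q (up x i) (up x j) :=
  Relation.ReflTransGen.single ⟨h i j, x, i, j, rfl, rfl⟩

theorem two_le_cutNum {m : ℕ} {Q : Node (m + 1) → Fin 4} {x : Node m} (h : ¬ Mono Q x) :
    2 ≤ ∑ k, cutNum Q x k := by
  by_contra hlt
  apply h
  rw [Fin.sum_univ_three] at hlt
  have e0 : cutNum Q x 0 = if Q (up x 1) = Q (up x 2) then 0 else 1 := by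
    rw [cutNum]
    rfl
  have e1 : cutNum Q x 1 = if Q (up x 2) = Q (up x 0) then 0 else 1 := by
    rw [cutNum]
    rfl
  have e2 : cutNum Q x 2 = if Q (up x 0) = Q (up x 1) then 0 else 1 := by
    rw [cutNum]
    rfl
  rw [e0, e1, e2] at hlt
  have key : Q (up x 0) = Q (up x 1) ∧ Q (up x 1) = Q (up x 2) := by
    split_ifs at hlt <;> omega
  intro i j
  fin_cases i <;> fin_cases j <;> simp [key.1, key.2]

/-- The set of missed sides depends only on the component; taking its least element makes the choice
constant on components. -/
theorem exists_missed_side {m : ℕ} (Q : Node (m + 1) → Fin 4)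
    (h : ∀ v : Node (m + 1), ∃ i : Fin 3, ∀ u, SameComp Q v u → 0 < u.1 i) :
    ∃ f : Node (m + 1) → Fin 3, (∀ v u, SameComp Q v u → 0 < u.1 (f v)) ∧
      ∀ v u, SameComp Q v u → f v = f u := by
  classical
  have hset : ∀ v u, SameComp Q v u → ∀ i : Fin 3,
      (∀ w, SameComp Q v w → 0 < w.1 i) ↔ ∀ w, SameComp Q u w → 0 < w.1 i :=
    fun v u hvu i => ⟨fun H w hw => H w (hvu.trans hw), fun H w hw => H w (hvu.symm.trans hw)⟩
  refine ⟨fun v => if ∀ w, SameComp Q v w → 0 < w.1 0 then 0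
    else if ∀ w, SameComp Q v w → 0 < w.1 1 then 1 else 2, ?_, ?_⟩
  · intro v
    dsimp only
    split_ifs with h0 h1
    · exact h0
    · exact h1
    · obtain ⟨i, hi⟩ := h v
      fin_cases i
      · exact absurd hi h0
      · exact absurd hi h1
      · exact hi
  · intro v u hvu
    simp only [hset v u hvu]

theorem succ_le_card_boundary (m : ℕ) :
    m + 1 ≤ (Finset.univ.filter fun x : Node m => x.1 0 = 0).card := by
  have : (Finset.range (m + 1)).card ≤ (Finset.univ.filter fun x : Node m => x.1 0 = 0).card := by
    apply Finset.card_le_card_of_injOn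
      (fun j => if h : j ≤ m then (⟨![0, j, m - j], by
        simp [Fin.sum_univ_three, h]⟩ : Node m) else terminal m 0)
    · intro j hj
      have hj' : j ≤ m := by
        have := Finset.mem_range.1 hj
        omega
      simp [hj']
    · intro i hi j hj hij
      have hi' : i ≤ m := by
        have := Finset.mem_range.1 hi
        omega
      have hj' : j ≤ m := by
        have := Finset.mem_range.1 hj
        omega
      simp only [dif_pos hi', dif_pos hj'] at hij
      have := congrArg (fun v : Node m => v.1 1) hij
      simpa using this
  simpa using this

/-- A node `z : Node m` stands for the downward triangle bordering the three cells `up z i`. Any two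
of these cells share a vertex. If both are monochromatic, they lie in one component with one chosen
side `i`, and so coincide: at most one monochromatic cell is sent to each `z`. -/
theorem le_cuts_of_missing {m : ℕ} (Q : Node (m + 1 + 1) → Fin 4)
    (h : ∀ v : Node (m + 1 + 1), ∃ i : Fin 3, ∀ u, SameComp Q v u → 0 < u.1 i) :
    2 * (m + 1 + 1) ≤ ∑ x : Node (m + 1), ∑ k, cutNum Q x k := by
  classical
  obtain ⟨f, hf, hfc⟩ := exists_missed_side Q h
  have hpos : ∀ x : Node (m + 1), Mono Q x → 0 < x.1 (f (up x 0)) := by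
    intro x hx
    have := hf _ _ (hx.sameComp 0 (f (up x 0) + 1))
    rwa [up_of_ne x (ne_add_one _)] at this
  have hex : ∀ x : Node (m + 1), ∃ z : Node m, Mono Q x → up z (f (up x 0)) = x := by
    intro x
    by_cases hx : Mono Q x
    · obtain ⟨z, hz⟩ := exists_up x _ (hpos x hx)
      exact ⟨z, fun _ => hz⟩
    -- Arbitrary value, as the map matters only on monochromatic cells.
    · exact ⟨terminal m 0, fun h => absurd h hx⟩
  choose g hg using hex
  have hinj : ∀ x y, Mono Q x → Mono Q y → g x = g y → x = y := by
    intro x y hx hy hxy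
    have h1 := hg x hx
    have h2 := hg y hy
    rw [← hxy] at h2
    have hshare : up x (f (up y 0)) = up y (f (up x 0)) := by
      apply Subtype.ext
      funext i
      have e1 := congrArg (fun v : Node (m + 1) => v.1 i) h1
      have e2 := congrArg (fun v : Node (m + 1) => v.1 i) h2
      simp only [up_apply] at e1 e2 ⊢
      omega
    have hfe : f (up x 0) = f (up y 0) :=
      (hfc _ _ (hx.sameComp 0 (f (up y 0)))).trans
        (hshare ▸ (hfc _ _ (hy.sameComp 0 (f (up x 0)))).symm)
    rw [← h1, ← h2, hfe]
  -- Downward triangles are in turn embedded by `up · 0` among the cells off the side `x 0 = 0`,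
  -- which leaves out at least `m + 2 = n` cells.
  have hcard : (Finset.univ.filter (Mono Q)).card ≤
      (Finset.univ.filter fun x : Node (m + 1) => ¬ x.1 0 = 0).card := by
    apply Finset.card_le_card_of_injOn (fun x => up (g x) 0)
    · intro x _
      simp [up_self]
    · intro x hx y hy hxy
      exact hinj x y (Finset.mem_filter.1 hx).2 (Finset.mem_filter.1 hy).2 (up_injective 0 hxy)
  have h1 := Finset.card_filter_add_card_filter_not (s := (Finset.univ : Finset (Node (m + 1))))
    (Mono Q)
  have h2 := Finset.card_filter_add_card_filter_not (s := (Finset.univ : Finset (Node (m + 1))))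
    (fun x => x.1 0 = 0)
  have h3 := succ_le_card_boundary (m + 1)
  calc 2 * (m + 1 + 1) ≤ (Finset.univ.filter fun x => ¬ Mono Q x).card * 2 := by omega
    _ = ∑ x ∈ Finset.univ.filter (fun x => ¬ Mono Q x), 2 := by
        rw [Finset.sum_const, smul_eq_mul]
    _ ≤ ∑ x ∈ Finset.univ.filter (fun x => ¬ Mono Q x), ∑ k, cutNum Q x k :=
        Finset.sum_le_sum fun x hx => two_le_cutNum (Finset.mem_filter.1 hx).2
    _ ≤ _ := Finset.sum_le_sum_of_subset (Finset.filter_subset _ _)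

theorem le_cuts {m : ℕ} (hm : 0 < m) (Q : Node (m + 1) → Fin 4)
    (hno : ∀ (v : Node (m + 1)) (i : Fin 3), Q v = i.castSucc → 0 < v.1 i)
    (hcorner : ∀ (a : Fin 3) (v : Node (m + 1)), 2 * (m + 1) < 3 * v.1 a → Q v = a.castSucc) :
    2 * (m + 1) ≤ ∑ x : Node m, ∑ k, cutNum Q x k := by
  by_cases h : ∀ v : Node (m + 1), ∃ i : Fin 3, ∀ u, SameComp Q v u → 0 < u.1 i
  · cases m with
    | zero => omega
    | succ m => exact le_cuts_of_missing Q h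
  · push Not at h
    obtain ⟨v, hv⟩ := h
    exact le_cuts_of_spanning Q hno hcorner v fun i => by
      obtain ⟨u, h1, h2⟩ := hv i
      exact ⟨u, h1, by omega⟩

/-! ### The cost of labellings that are constant on the corners -/

/-- A boundary edge leaving a corner. -/
def Deficit {m : ℕ} (x : Node m) (k b : Fin 3) : Prop :=
  x.1 k = 0 ∧ 3 * x.1 b ≤ 2 * (m + 1) ∧ 2 * (m + 1) < 3 * (x.1 b + 1)

open Classical in
theorem sum_deficit_le {m : ℕ} {k b : Fin 3} (hkb : k ≠ b) :
    ∑ x : Node m, (if Deficit x k b then (1 : ℝ) else 0) ≤ 1 := by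
  rw [Finset.sum_boole]
  have : (Finset.univ.filter fun x : Node m => Deficit x k b).card ≤ 1 := by
    apply Finset.card_le_one.2
    intro x hx y hy
    obtain ⟨h1, h2, h3⟩ := (Finset.mem_filter.1 hx).2
    obtain ⟨h4, h5, h6⟩ := (Finset.mem_filter.1 hy).2
    exact Node.ext_of_two hkb (by omega) (by omega)
  exact_mod_cast this

-- With filled corners, a cut edge has at most one end in a corner. If it is a boundary edge with an
-- end there, its cost is `x_b + 1 - 2n/3` times `ρ`; this factor is a positive multiple of `1/3`,
-- so at most `2ρ/3` is missing.
open Classical in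
theorem cut_le_weight {m : ℕ} (hm : 9 ≤ m) (Q : Node (m + 1) → Fin 4)
    (hcorner : ∀ (a : Fin 3) (v : Node (m + 1)), 2 * (m + 1) < 3 * v.1 a → Q v = a.castSucc)
    (x : Node m) (k : Fin 3) :
    rho (m + 1) * cutNum Q x k ≤ weight x k * cutInd Q x k
      + 2 / 3 * rho (m + 1) * ((if Deficit x k (k + 1) then 1 else 0)
        + if Deficit x k (k + 2) then 1 else 0) := by
  have hr := rho_pos (Nat.succ_pos m)
  have hd1 : (0 : ℝ) ≤ if Deficit x k (k + 1) then 1 else 0 := by split_ifs <;> norm_num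
  have hd2 : (0 : ℝ) ≤ if Deficit x k (k + 2) then 1 else 0 := by split_ifs <;> norm_num
  have hadd := mul_nonneg (mul_nonneg (by norm_num : (0 : ℝ) ≤ 2 / 3) hr.le) (add_nonneg hd1 hd2)
  by_cases hQ : Q (up x (k + 1)) = Q (up x (k + 2))
  · rw [cutNum, if_pos hQ, cutInd_eq_zero hQ]
    push_cast
    linarith
  rw [cutNum_eq_one hQ, cutInd_eq_one hQ, mul_one, Nat.cast_one, mul_one]
  have hnot : ∀ a, 3 * x.1 a ≤ 2 * (m + 1) := by
    intro a
    by_contra hlt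
    apply hQ
    have h1 := le_up x (k + 1) a
    have h2 := le_up x (k + 2) a
    rw [hcorner a _ (by omega), hcorner a _ (by omega)]
  have hside : ∀ b, b ≠ k → 2 * (m + 1) < 3 * (x.1 b + 1) →
      rho (m + 1) ≤ weight x k + 2 / 3 * rho (m + 1) * (if Deficit x k b then 1 else 0) := by
    intro b hb hlt
    rw [weight_of_corner hm x hb hlt]
    by_cases h0 : x.1 k = 0
    · rw [if_pos h0, if_pos ⟨h0, hnot b, hlt⟩]
      have h1 : (2 * ((m : ℝ) + 1) + 1) ≤ 3 * ((x.1 b : ℝ) + 1) := by exact_mod_cast hlt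
      have h2 : (1 : ℝ) / 3 ≤ (x.1 b : ℝ) + 1 - 2 * ((m : ℝ) + 1) / 3 := by linarith
      have := mul_le_mul_of_nonneg_right h2 hr.le
      linarith
    · rw [if_neg h0]
      have : (0 : ℝ) ≤ if Deficit x k b then 1 else 0 := by split_ifs <;> norm_num
      have := mul_nonneg (mul_nonneg (by norm_num : (0 : ℝ) ≤ 2 / 3) hr.le) this
      linarith
  have hpos : (0 : ℝ) ≤ 2 / 3 * rho (m + 1) := by positivity
  have hp1 := mul_nonneg hpos hd1
  have hp2 := mul_nonneg hpos hd2
  rw [mul_add]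
  by_cases hb : 2 * (m + 1) < 3 * (x.1 (k + 1) + 1)
  · have := hside _ (ne_add_one k).symm hb
    linarith
  by_cases hc : 2 * (m + 1) < 3 * (x.1 (k + 2) + 1)
  · have := hside _ (ne_add_two k).symm hc
    linarith
  rw [weight_of_center x (hnot k) (by omega) (by omega)]
  linarith

theorem totalCost_ge_of_corners {m : ℕ} (hm : 9 ≤ m) (Q : Node (m + 1) → Fin 4)
    (hno : ∀ (v : Node (m + 1)) (i : Fin 3), Q v = i.castSucc → 0 < v.1 i)
    (hcorner : ∀ (a : Fin 3) (v : Node (m + 1)), 2 * (m + 1) < 3 * v.1 a → Q v = a.castSucc) :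
    1.2 - 5 / (2 * ((m : ℝ) + 1)) ≤ totalCost Q := by
  classical
  have hr := rho_pos (Nat.succ_pos m)
  have hcuts : 2 * ((m : ℝ) + 1) ≤ ∑ x : Node m, ∑ k, (cutNum Q x k : ℝ) := by
    exact_mod_cast le_cuts (by omega) Q hno hcorner
  have hsum := Finset.sum_le_sum fun (x : Node m) (_ : x ∈ Finset.univ) =>
    Finset.sum_le_sum fun (k : Fin 3) (_ : k ∈ Finset.univ) => cut_le_weight hm Q hcorner x k
  simp only [Finset.sum_add_distrib, ← Finset.mul_sum] at hsum
  -- Three sides for each of the two shifts `d`: six deficient edges, hence a loss of at most `4ρ`,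
  -- within the allowed `25ρ/6 = 5/(2n)`.
  have hdef : ∀ d : Fin 3, (∀ k : Fin 3, k ≠ k + d) →
      ∑ x : Node m, ∑ k : Fin 3, (if Deficit x k (k + d) then (1 : ℝ) else 0) ≤ 3 := by
    intro d hd
    rw [Finset.sum_comm, Fin.sum_univ_three]
    have h0 := sum_deficit_le (m := m) (hd 0)
    have h1 := sum_deficit_le (m := m) (hd 1)
    have h2 := sum_deficit_le (m := m) (hd 2)
    linarith
  have hd1 := hdef 1 ne_add_one
  have hd2 := hdef 2 ne_add_two
  have hr' : rho (m + 1) * ((m : ℝ) + 1) = 3 / 5 := by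
    have : (m : ℝ) + 1 ≠ 0 := by positivity
    rw [rho]
    push_cast
    field_simp
  have h1 := mul_le_mul_of_nonneg_left hcuts hr.le
  have h2 := mul_le_mul_of_nonneg_left (add_le_add hd1 hd2)
    (by positivity : (0 : ℝ) ≤ 2 / 3 * rho (m + 1))
  have h3 : 5 / (2 * ((m : ℝ) + 1)) = 25 / 6 * rho (m + 1) := by
    rw [rho]
    push_cast
    field_simp
    norm_num
  have h4 : totalCost Q = ∑ x : Node m, ∑ k, weight x k * cutInd Q x k := rfl
  rw [h3, h4]
  linarith

theorem terminal_apply_of_ne (n : ℕ) {i j : Fin 3} (h : j ≠ i) : (terminal n i).1 j = 0 :=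
  Pi.single_eq_of_ne h _

theorem totalCost_ge {m : ℕ} (hm : 9 ≤ m) (Q : Node (m + 1) → Fin 4) (hcut : IsCut Q)
    (hno : ∀ (v : Node (m + 1)) (i : Fin 3), Q v = i.castSucc → 0 < v.1 i) :
    1.2 - 5 / (2 * ((m : ℝ) + 1)) ≤ totalCost Q := by
  have hterm : ∀ a b : Fin 3, a ≠ b → ¬ 2 * (m + 1) < 3 * (terminal (m + 1) b).1 a := by
    intro a b h
    simp [terminal_apply_of_ne _ h]
  obtain ⟨Q₀, h0, h0', c0⟩ := exists_filled_corner hm 0 Q (hcut 0)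
  obtain ⟨Q₁, h1, h1', c1⟩ := exists_filled_corner hm 1 Q₀
    (by rw [h0' _ (hterm 0 1 (by decide)), hcut])
  obtain ⟨Q₂, h2, h2', c2⟩ := exists_filled_corner hm 2 Q₁
    (by rw [h1' _ (hterm 1 2 (by decide)), h0' _ (hterm 0 2 (by decide)), hcut])
  have hdisj : ∀ (v : Node (m + 1)) (a b : Fin 3), a ≠ b → 2 * (m + 1) < 3 * v.1 a →
      ¬ 2 * (m + 1) < 3 * v.1 b := by
    intro v a b hab ha
    have := v.add_le hab
    omega
  have hcorner : ∀ (a : Fin 3) (v : Node (m + 1)), 2 * (m + 1) < 3 * v.1 a →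
      Q₂ v = a.castSucc := by
    intro a v hv
    have hd : ∀ b, a ≠ b → ¬ 2 * (m + 1) < 3 * v.1 b := fun b hab => hdisj v a b hab hv
    fin_cases a
    · rw [h2' v (hd 2 (by decide)), h1' v (hd 1 (by decide))]
      exact h0 v hv
    · rw [h2' v (hd 2 (by decide))]
      exact h1 v hv
    · exact h2 v hv
  refine (totalCost_ge_of_corners hm Q₂ ?_ hcorner).trans (c2.trans (c1.trans c0))
  intro v i hi
  by_cases h : ∃ a : Fin 3, 2 * (m + 1) < 3 * v.1 a
  · obtain ⟨a, ha⟩ := h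
    have := hcorner a v ha
    rw [hi] at this
    rw [Fin.castSucc_injective 3 this]
    omega
  · push Not at h
    rw [h2' v (not_lt.2 (h 2)), h1' v (not_lt.2 (h 1)), h0' v (not_lt.2 (h 0))] at hi
    exact hno v i hi

/-! ### Red triangles in integer coordinates -/

theorem level_le_pt_iff {m t d : ℕ} {c : ℝ} (hc : c * ((m : ℝ) + 1) = d) (htd : t + d = m + 1)
    (v : Node (m + 1)) (i : Fin 3) : 1 - c ≤ v.pt i ↔ t ≤ v.1 i := by
  have hm : (0 : ℝ) < (m : ℝ) + 1 := by positivity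
  have h : (t : ℝ) + d = m + 1 := by exact_mod_cast htd
  have e : (1 - c) * ((m : ℝ) + 1) = t := by linarith
  rw [pt_div]
  push_cast
  rw [le_div_iff₀ hm, e, Nat.cast_le]

theorem pt_eq_level_iff {m t d : ℕ} {c : ℝ} (hc : c * ((m : ℝ) + 1) = d) (htd : t + d = m + 1)
    (v : Node (m + 1)) (i : Fin 3) : v.pt i = 1 - c ↔ v.1 i = t := by
  have hm : (m : ℝ) + 1 ≠ 0 := by positivity
  have h : (t : ℝ) + d = m + 1 := by exact_mod_cast htd
  have e : (1 - c) * ((m : ℝ) + 1) = t := by linarith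
  rw [pt_div]
  push_cast
  rw [div_eq_iff hm, e, Nat.cast_inj]

/-- Red edges lead from `s_a` along one side down to row `t`, then along that row; without a cut
among them the label `a` propagates. -/
theorem label_eq_of_no_red_cut {m t d : ℕ} {c : ℝ} (hc : c * ((m : ℝ) + 1) = d)
    (htd : t + d = m + 1) (Q : Node (m + 1) → Fin 4) (hcut : IsCut Q) (a : Fin 3)
    (hred : cutSet Q ∩ redEdges (m + 1) c a = ∅) :
    (∀ v : Node (m + 1), v.1 a = t → Q v = a.castSucc) ∧
      ∀ v : Node (m + 1), t ≤ v.1 a → v.1 (a + 1) = 0 → Q v = a.castSucc := by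
  have hedge : ∀ (x : Node m) (p q : Fin 3), p ≠ q → up x p ∈ redNodes (m + 1) c a →
      up x q ∈ redNodes (m + 1) c a → Q (up x p) = Q (up x q) := by
    intro x p q hpq hp hq
    by_contra h
    have : s(up x p, up x q) ∈ cutSet Q ∩ redEdges (m + 1) c a :=
      ⟨⟨_, _, graph_adj_up x hpq, h, rfl⟩, ⟨_, _, graph_adj_up x hpq, hp, hq, rfl⟩⟩
    rw [hred] at this
    exact this
  have hmem_row : ∀ v : Node (m + 1), v.1 a = t → v ∈ redNodes (m + 1) c a := fun v hv =>
    Or.inl ((pt_eq_level_iff hc htd v a).2 hv)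
  have hmem_side : ∀ v : Node (m + 1), t ≤ v.1 a → v.1 (a + 1) = 0 →
      v ∈ redNodes (m + 1) c a := fun v hv h0 =>
    Or.inr ⟨⟨a + 2, (ne_add_two a).symm, (mem_side_iff (Nat.succ_pos m) v (ne_add_two a).symm
      (add_one_ne_add_two a).symm (ne_add_one a)).2 h0⟩, (level_le_pt_iff hc htd v a).2 hv⟩
  have hside : ∀ v : Node (m + 1), t ≤ v.1 a → v.1 (a + 1) = 0 → Q v = a.castSucc := by
    intro v hv h0
    by_contra hne
    obtain ⟨x, h1, -, h3, h4⟩ := exists_cut_on_line Q (ne_add_two a).symm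
      (add_one_ne_add_two a) (ne_add_one a).symm 0 0 a.castSucc (fun u h1 h2 => by
        rw [← hcut a]
        congr 1
        apply Node.ext_of_two (add_one_ne_add_two a)
        · rw [h2, terminal_apply_of_ne _ (ne_add_one a).symm]
        · rw [h1, terminal_apply_of_ne _ (ne_add_two a).symm]) v (Nat.zero_le _) h0 hne
    have hs := x.sum_eq a
    have hv' := v.sum_eq a
    refine h4 (hedge x _ _ (ne_add_two a).symm (hmem_side _ ?_ ?_) (hmem_side _ ?_ ?_))
    · rw [up_of_ne x (ne_add_two a)]
      omega
    · rw [up_of_ne x (add_one_ne_add_two a), h1]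
    · rw [up_self]
      omega
    · rw [up_of_ne x (ne_add_one a).symm, h1]
  refine ⟨fun v hv => ?_, hside⟩
  by_contra hne
  obtain ⟨x, h1, -, -, h4⟩ := exists_cut_on_line Q (add_one_ne_add_two a) (ne_add_one a)
    (ne_add_two a) 0 t a.castSucc (fun u h1 h2 => hside u h2.ge h1) v (Nat.zero_le _) hv hne
  refine h4 (hedge x _ _ (add_one_ne_add_two a) (hmem_row _ ?_) (hmem_row _ ?_))
  · rw [up_of_ne x (ne_add_one a), h1]
  · rw [up_of_ne x (ne_add_two a), h1]

/-- `Q₀` is the original cut, which defines the islands, while `Q` may already be filled near other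
terminals. Agreement on the closure at `a` lets the removals be chained. -/
theorem exists_island_removal {m t d : ℕ} {c : ℝ} (hm : 9 ≤ m) (hc : c * ((m : ℝ) + 1) = d)
    (htd : t + d = m + 1) (ht : m + 1 < 2 * t) (Q₀ Q : Node (m + 1) → Fin 4) (hcut : IsCut Q₀)
    (a : Fin 3) (hagree : ∀ v : Node (m + 1), t ≤ v.1 a → Q v = Q₀ v) :
    ∃ Q' : Node (m + 1) → Fin 4,
      (∀ v : Node (m + 1), v.1 a < t → Q' v = Q v) ∧
      (∀ v : Node (m + 1), Q' v = Q v ∨ Q' v = a.castSucc ∧ t ≤ v.1 a) ∧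
      totalCost Q' + 0.4 * ((redIsland c Q₀ a).ncard : ℝ) / ((m : ℝ) + 1) ^ 2 ≤ totalCost Q := by
  classical
  by_cases hred : cutSet Q₀ ∩ redEdges (m + 1) c a = ∅
  · obtain ⟨hrow, hside⟩ := label_eq_of_no_red_cut hc htd Q₀ hcut a hred
    refine ⟨fillCorner a t Q, fun v hv => fillCorner_of_lt hv, fun v => ?_, ?_⟩
    · rcases le_or_gt t (v.1 a) with h | h
      · exact Or.inr ⟨fillCorner_of_le h, h⟩
      · exact Or.inl (fillCorner_of_lt h)
    · have hA : redIsland c Q₀ a = ((Finset.univ.filter fun v : Node (m + 1) =>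
          t ≤ v.1 a ∧ Q v = Fin.last 3 : Finset (Node (m + 1))) : Set (Node (m + 1))) := by
        rw [redIsland, if_pos hred]
        ext v
        simp only [Finset.coe_filter, Finset.mem_univ, true_and]
        change (1 - c ≤ v.pt a ∧ Q₀ v = Fin.last 3) ↔ (t ≤ v.1 a ∧ Q v = Fin.last 3)
        rw [level_le_pt_iff hc htd]
        constructor
        · rintro ⟨h1, h2⟩
          exact ⟨h1, by rw [hagree v h1, h2]⟩
        · rintro ⟨h1, h2⟩
          exact ⟨h1, by rw [← hagree v h1, h2]⟩
      rw [hA, Set.ncard_coe_finset]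
      exact totalCost_fillCorner_add_le hm Q a t ht
        (fun v hv => by rw [hagree v hv.ge, hrow v hv])
        (fun v hv h0 => by rw [hagree v hv, hside v hv h0])
  · refine ⟨Q, fun _ _ => rfl, fun _ => Or.inl rfl, ?_⟩
    rw [redIsland, if_neg hred]
    simp

theorem island_bound {m t d : ℕ} {c : ℝ} (hm : 9 ≤ m) (hc : c * ((m : ℝ) + 1) = d)
    (htd : t + d = m + 1) (ht : m + 1 < 2 * t) (Q : Node (m + 1) → Fin 4)
    (hQ : IsNonOppositeCut Q) :
    1.2 + 0.4 * (∑ i : Fin 3, ((redIsland c Q i).ncard : ℝ)) / ((m : ℝ) + 1) ^ 2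
      - 5 / (2 * ((m : ℝ) + 1)) ≤ totalCost Q := by
  obtain ⟨hcut, hopp⟩ := hQ
  have hno : ∀ (v : Node (m + 1)) (i : Fin 3), Q v = i.castSucc → 0 < v.1 i := by
    intro v i hi
    rcases hopp v with ⟨j, hj, hji⟩ | h
    · rw [hi] at hji
      rw [← Fin.castSucc_injective 3 hji]
      by_contra h0
      apply hj
      rw [pt_div, Nat.eq_zero_of_not_pos h0]
      simp
    · rw [hi] at h
      exact absurd h (Fin.castSucc_lt_last i).ne
  have hdisj : ∀ (v : Node (m + 1)) (a b : Fin 3), a ≠ b → t ≤ v.1 a → v.1 b < t := by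
    intro v a b hab ha
    have := v.add_le hab
    omega
  obtain ⟨Q₀, a0, b0, c0⟩ := exists_island_removal hm hc htd ht Q Q hcut 0 fun _ _ => rfl
  obtain ⟨Q₁, a1, b1, c1⟩ := exists_island_removal hm hc htd ht Q Q₀ hcut 1
    fun v hv => a0 v (hdisj v 1 0 (by decide) hv)
  obtain ⟨Q₂, a2, b2, c2⟩ := exists_island_removal hm hc htd ht Q Q₁ hcut 2
    fun v hv => (a1 v (hdisj v 2 1 (by decide) hv)).trans (a0 v (hdisj v 2 0 (by decide) hv))
  have hstep : ∀ v, Q₂ v = Q v ∨ ∃ a : Fin 3, Q₂ v = a.castSucc ∧ t ≤ v.1 a := by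
    intro v
    rcases b2 v with h | h
    · rcases b1 v with h' | h'
      · rcases b0 v with h'' | h''
        · exact Or.inl (h.trans (h'.trans h''))
        · exact Or.inr ⟨0, by rw [h, h', h''.1], h''.2⟩
      · exact Or.inr ⟨1, by rw [h, h'.1], h'.2⟩
    · exact Or.inr ⟨2, h⟩
  have hcut₂ : IsCut Q₂ := by
    intro i
    rcases hstep (terminal (m + 1) i) with h | ⟨a, h1, h2⟩
    · rw [h, hcut]
    · have : a = i := by
        by_contra hne
        rw [terminal_apply_of_ne _ hne] at h2
        omega
      rw [h1, this]
  have hno₂ : ∀ (v : Node (m + 1)) (i : Fin 3), Q₂ v = i.castSucc → 0 < v.1 i := by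
    intro v i hi
    rcases hstep v with h | ⟨a, h1, h2⟩
    · exact hno v i (by rw [← h, hi])
    · rw [hi] at h1
      rw [Fin.castSucc_injective 3 h1]
      omega
  have hmain := totalCost_ge hm Q₂ hcut₂ hno₂
  rw [Fin.sum_univ_three, mul_add, mul_add, add_div, add_div]
  linarith

end MultiwayCut

theorem corollary9 (n : ℕ) (hn : 10 ≤ n) (c : ℝ) (hc0 : 0 < c) (hc : c < 1 / 2)
    (hcn : ∃ m : ℤ, c * n = m) (Q : MultiwayCut.Node n → Fin 4)
    (hQ : MultiwayCut.IsNonOppositeCut Q) :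
    1.2 + 0.4 * (∑ i : Fin 3, ((MultiwayCut.redIsland c Q i).ncard : ℝ)) / (n : ℝ) ^ 2
        - 5 / (2 * (n : ℝ))
      ≤ MultiwayCut.costJ n (MultiwayCut.cutSet Q) := by
  obtain ⟨m, rfl⟩ : ∃ m, n = m + 1 := ⟨n - 1, by omega⟩
  obtain ⟨z, hz⟩ := hcn
  have hz0 : 0 ≤ z := by
    have : (0 : ℝ) ≤ z := by
      rw [← hz]
      positivity
    exact_mod_cast this
  lift z to ℕ using hz0 with d
  have hm : (0 : ℝ) < (m : ℝ) + 1 := by positivity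
  push_cast at hz ⊢
  have hd : 2 * d < m + 1 := by
    have : 2 * (d : ℝ) < m + 1 := by
      rw [← hz]
      nlinarith
    exact_mod_cast this
  exact (MultiwayCut.island_bound (t := m + 1 - d) (by omega) hz (by omega) (by omega) Q hQ).trans
    (MultiwayCut.totalCost_le_costJ Q)
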